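/- **Setting.** Let $\mathcal A$ be a separable unital $C^*$-algebra, and let $\sigma$ be an automorphism of $\mathcal A$ with $\sigma^2=\mathrm{id}$ (the grading). Let $\alpha$ be an action of $\mathbb Z^d$ on $\mathcal A$ by automorphisms commuting with $\sigma$, and let $(\Omega,\mu)$ be a standard probability space with a measure preserving action $T_x$ ($x\in\mathbb Z^d$). For each $\omega\in\Omega$ let $(\tau^\omega_t)_{t\in\mathbb R}$ be a one-parameter group of automorphisms of $\mathcal A$. Put $\mathfrak A:=\mathcal A\otimes L^\infty(\Omega,\mu)$, the closed $*$-subalgebra of $L^\infty(\Omega,\mu;\mathcal A)$ generated by the functions $\omega\mapsto f(\omega)A$. Assume that $(t,\omega)\mapsto\tau^\omega_t(A)$ is jointly measurable for each $A\in\mathcal A$, that $\omega\mapsto\tau^\omega_t(A)$ belongs to $\mathfrak A$ for all $A\in\mathcal A$, $t\in\mathbb R$, that $\tau_t^{T_x\omega}\alpha_x=\alpha_x\tau^\omega_t$, and that for all $t$ and $A$ one has $\tau^\omega_t(\sigma(A))=\sigma(\tau^\omega_t(A))$ for almost all $\omega$. On $\mathfrak A$ consider the evolution $\mathfrak t_t(A)(\omega)=\tau^\omega_t(A(\omega))$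 and the grading $\mathfrak s(A)(\omega)=\sigma(A(\omega))$. A state is *even* if it is $\mathfrak s$-invariant. Let $\beta\neq0$ and let $\varphi$ be an even $\mathfrak t$-KMS state on $\mathfrak A$ at inverse temperature $\beta$ whose restriction to $L^\infty(\Omega,\mu)$ is normal, with GNS triple $(\mathcal H_\varphi,\pi_\varphi,\Phi)$. Let $\mathfrak Z_\varphi$ be the centre of $\pi_\varphi(\mathfrak A)''$. Let $\varphi_T$ be an even $\mathfrak t$-KMS state on $\mathfrak A$ at inverse temperature $\beta$, normal with respect to $\varphi$ and described by a positive operator $T$ affiliated with $\mathfrak Z_\varphi$, that is, $\varphi_T(A)=\langle\pi_\varphi(A)T^{1/2}\Phi,T^{1/2}\Phi\rangle$ for $A\in\mathfrak A$. Suppose that $T$ is bounded. **Claim.** 1. $T$ is even: there is a unitary $V$ on $\mathcal H_\varphi$ with $V\Phi=\Phi$ and $V\pi_\varphi(A)V^*=\pi_\varphi(\mathfrak s(A))$ for all $A\in\mathfrak A$ (necessarily unique), and $VTV=T$. 2. Let $\varphi(A)=\int_\Omega\varphi_\omega(A(\omega))\,d\mu(\omega)$ be the decomposition of $\varphi$ through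 a weak-$*$ measurable field of positive forms $\varphi_\omega$ on $\mathcal A$, with GNS triples $(\mathcal H_\omega,\pi_\omega,\Psi_\omega)$. Let $T(\omega)$ be a measurable field of positive self-adjoint (possibly unbounded) operators on $\mathcal H_\omega$, almost surely affiliated with the centre of $\pi_\omega(\mathcal A)''$ and with $\Psi_\omega$ in the domain of $T(\omega)^{1/2}$, such that $$\varphi_T(A)=\int_\Omega\big\langle\pi_\omega(A(\omega))T(\omega)^{1/2}\Psi_\omega,\,T(\omega)^{1/2}\Psi_\omega\big\rangle\,d\mu(\omega),\qquad A\in\mathfrak A .$$ Then, for almost all $\omega$, $T(\omega)$ is bounded and even: there is a unitary $V_\omega$ on $\mathcal H_\omega$ with $V_\omega\Psi_\omega=\Psi_\omega$, $V_\omega\pi_\omega(A)V_\omega^*=\pi_\omega(\sigma(A))$ for all $A\in\mathcal A$, and $V_\omega T(\omega)V_\omega=T(\omega)$. -/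

import Mathlib

open MeasureTheory
open scoped ENNReal

/-! ### The C*-algebra `L^∞(Ω, μ; A)` of essentially bounded functions with values in `A` -/

noncomputable section

namespace LInfinity

variable {Ω A : Type*} [MeasurableSpace Ω] {μ : Measure Ω} [CStarAlgebra A]

instance instMul : Mul (Lp A ∞ μ) where
  mul f g := ((Lp.memLp g).mul (Lp.memLp f) : MemLp (⇑f * ⇑g) ∞ μ).toLp (⇑f * ⇑g)

instance instOne : One (Lp A ∞ μ) where
  one := (memLp_top_const (1 : A)).toLp (fun _ => (1 : A))

theorem coeFn_mul (f g : Lp A ∞ μ) : ∀ᵐ ω ∂μ, (f * g : Lp A ∞ μ) ω = f ω * g ω :=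
  MemLp.coeFn_toLp ((Lp.memLp g).mul (Lp.memLp f) : MemLp (⇑f * ⇑g) ∞ μ)

theorem coeFn_one : ∀ᵐ ω ∂μ, (1 : Lp A ∞ μ) ω = 1 :=
  MemLp.coeFn_toLp (memLp_top_const (1 : A))

theorem coeFn_add (f g : Lp A ∞ μ) : ∀ᵐ ω ∂μ, (f + g : Lp A ∞ μ) ω = f ω + g ω :=
  Lp.coeFn_add f g

theorem coeFn_smul (c : ℂ) (f : Lp A ∞ μ) : ∀ᵐ ω ∂μ, (c • f : Lp A ∞ μ) ω = c • f ω :=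
  Lp.coeFn_smul c f

theorem coeFn_star (f : Lp A ∞ μ) : ∀ᵐ ω ∂μ, (star f : Lp A ∞ μ) ω = star (f ω) :=
  Lp.coeFn_star f

theorem norm_coeFn_le (f : Lp A ∞ μ) : ∀ᵐ ω ∂μ, ‖f ω‖ ≤ ‖f‖ := by
  filter_upwards [enorm_ae_le_eLpNormEssSup f μ] with ω h
  have h' : ‖f ω‖ₑ ≤ eLpNorm f ∞ μ := by simpa using h
  rw [Lp.norm_def]
  simpa using ENNReal.toReal_mono (Lp.eLpNorm_ne_top f) h'

theorem norm_le_of_ae (f : Lp A ∞ μ) {C : ℝ} (hC : 0 ≤ C) (h : ∀ᵐ ω ∂μ, ‖f ω‖ ≤ C) :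
    ‖f‖ ≤ C := by
  rw [Lp.norm_def, eLpNorm_exponent_top]
  exact ENNReal.toReal_le_of_le_ofReal hC (eLpNormEssSup_le_of_ae_bound h)

instance instNormedRing : NormedRing (Lp A ∞ μ) where
  __ := (inferInstance : NormedAddCommGroup (Lp A ∞ μ))
  mul := (· * ·)
  one := 1
  left_distrib f g h := by
    apply Lp.ext
    filter_upwards [coeFn_mul f (g + h), coeFn_add g h, coeFn_add (f * g) (f * h),
      coeFn_mul f g, coeFn_mul f h] with ω h1 h2 h3 h4 h5
    rw [h1, h2, h3, h4, h5, mul_add]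
  right_distrib f g h := by
    apply Lp.ext
    filter_upwards [coeFn_mul (f + g) h, coeFn_add f g, coeFn_add (f * h) (g * h),
      coeFn_mul f h, coeFn_mul g h] with ω h1 h2 h3 h4 h5
    rw [h1, h2, h3, h4, h5, add_mul]
  zero_mul f := by
    apply Lp.ext
    filter_upwards [coeFn_mul 0 f, Lp.coeFn_zero A ∞ μ] with ω h1 h2
    rw [h1, h2]; simp
  mul_zero f := by
    apply Lp.ext
    filter_upwards [coeFn_mul f 0, Lp.coeFn_zero A ∞ μ] with ω h1 h2
    rw [h1, h2]; simp
  mul_assoc f g h := by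
    apply Lp.ext
    filter_upwards [coeFn_mul (f * g) h, coeFn_mul f (g * h), coeFn_mul f g,
      coeFn_mul g h] with ω h1 h2 h3 h4
    rw [h1, h2, h3, h4, mul_assoc]
  one_mul f := by
    apply Lp.ext
    filter_upwards [coeFn_mul 1 f, coeFn_one (A := A) (μ := μ)] with ω h1 h2
    rw [h1, h2, one_mul]
  mul_one f := by
    apply Lp.ext
    filter_upwards [coeFn_mul f 1, coeFn_one (A := A) (μ := μ)] with ω h1 h2
    rw [h1, h2, mul_one]
  norm_mul_le f g := by
    apply norm_le_of_ae _ (by positivity)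
    filter_upwards [coeFn_mul f g, norm_coeFn_le f, norm_coeFn_le g] with ω h1 h2 h3
    rw [h1]
    exact (norm_mul_le _ _).trans (by gcongr)

instance instCStarAlgebra : CStarAlgebra (Lp A ∞ μ) where
  star_involutive := star_involutive
  star_mul f g := by
    apply Lp.ext
    filter_upwards [coeFn_star (f * g), coeFn_mul f g, coeFn_mul (star g) (star f),
      coeFn_star f, coeFn_star g] with ω h1 h2 h3 h4 h5
    rw [h1, h2, h3, h4, h5, star_mul]
  star_add f g := by
    apply Lp.ext
    filter_upwards [coeFn_star (f + g), coeFn_add f g, coeFn_add (star f) (star g),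
      coeFn_star f, coeFn_star g] with ω h1 h2 h3 h4 h5
    rw [h1, h2, h3, h4, h5, star_add]
  norm_mul_self_le f := by
    have h : ‖f‖ ≤ √‖star f * f‖ := by
      apply norm_le_of_ae _ (Real.sqrt_nonneg _)
      filter_upwards [coeFn_mul (star f) f, coeFn_star f, norm_coeFn_le (star f * f)]
        with ω h1 h2 h3
      apply Real.le_sqrt_of_sq_le
      rw [h1, h2, CStarRing.norm_star_mul_self] at h3
      rwa [sq]
    calc ‖f‖ * ‖f‖ ≤ √‖star f * f‖ * √‖star f * f‖ := by gcongr
      _ = ‖star f * f‖ := Real.mul_self_sqrt (norm_nonneg _)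
  __ := Algebra.ofModule
    (fun c f g => by
      apply Lp.ext
      filter_upwards [coeFn_mul (c • f) g, coeFn_smul c f, coeFn_smul c (f * g),
        coeFn_mul f g] with ω h1 h2 h3 h4
      rw [h1, h2, h3, h4, smul_mul_assoc])
    (fun c f g => by
      apply Lp.ext
      filter_upwards [coeFn_mul f (c • g), coeFn_smul c g, coeFn_smul c (f * g),
        coeFn_mul f g] with ω h1 h2 h3 h4
      rw [h1, h2, h3, h4, mul_smul_comm])
  norm_smul_le c f := norm_smul_le c f
  star_smul c f := by
    apply Lp.ext
    filter_upwards [coeFn_star (c • f), coeFn_smul c f, coeFn_smul (star c) (star f),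
      coeFn_star f] with ω h1 h2 h3 h4
    rw [h1, h2, h3, h4, star_smul]

/-- The elementary tensor `a ⊗ f`, that is, the function `ω ↦ f(ω) a`. -/
def tensor (a : A) (f : Lp ℂ ∞ μ) : Lp A ∞ μ :=
  (ContinuousLinearMap.toSpanSingleton ℂ a).compLp f

theorem coeFn_const_tensor [IsFiniteMeasure μ] (a : A) :
    ∀ᵐ ω ∂μ, tensor a (Lp.const ∞ μ (1 : ℂ)) ω = a := by
  filter_upwards [ContinuousLinearMap.coeFn_compLp (ContinuousLinearMap.toSpanSingleton ℂ a)
    (Lp.const ∞ μ (1 : ℂ)), Lp.coeFn_const ∞ μ (1 : ℂ)] with ω h1 h2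
  rw [tensor, h1, h2]
  simp

/-- A measurable field `F` of unital *-endomorphisms of `A` acts fibrewise on `L^∞(Ω, μ; A)`:
the image of `f` is the class of `ω ↦ F ω (f ω)`. -/
theorem memLp_fibre [TopologicalSpace.SeparableSpace A] (F : Ω → A →⋆ₐ[ℂ] A)
    (hF : ∀ a, StronglyMeasurable fun ω => F ω a) (f : Lp A ∞ μ) :
    MemLp (fun ω => F ω (f ω)) ∞ μ := by
  have hle : ∀ ω a, ‖F ω a‖ ≤ ‖a‖ := fun ω a => NonUnitalStarAlgHom.norm_apply_le (F ω) a
  refine memLp_top_of_bound ?_ ‖f‖ ?_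
  · borelize A
    have : SecondCountableTopology A := UniformSpace.secondCountable_of_separable A
    have hu : StronglyMeasurable (Function.uncurry fun (a : A) (ω : Ω) => F ω a) :=
      stronglyMeasurable_uncurry_of_continuous_of_stronglyMeasurable
        (fun ω => AddMonoidHomClass.continuous_of_bound (F ω) 1
          (fun a => by simpa using hle ω a)) hF
    exact (hu.comp_measurable
      ((Lp.stronglyMeasurable f).measurable.prodMk measurable_id)).aestronglyMeasurable
  · filter_upwards [norm_coeFn_le f] with ω h
    exact (hle ω _).trans h

/-- The fibrewise action of a measurable field of unital *-endomorphisms. -/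
def fibreHom [TopologicalSpace.SeparableSpace A] (F : Ω → A →⋆ₐ[ℂ] A)
    (hF : ∀ a, StronglyMeasurable fun ω => F ω a) : Lp A ∞ μ →⋆ₐ[ℂ] Lp A ∞ μ where
  toFun f := (memLp_fibre F hF f).toLp _
  map_one' := by
    apply Lp.ext
    filter_upwards [MemLp.coeFn_toLp (memLp_fibre F hF (1 : Lp A ∞ μ)),
      coeFn_one (A := A) (μ := μ)] with ω h1 h2
    rw [h1, h2, map_one]
  map_mul' f g := by
    apply Lp.ext
    filter_upwards [MemLp.coeFn_toLp (memLp_fibre F hF (f * g)),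
      MemLp.coeFn_toLp (memLp_fibre F hF f), MemLp.coeFn_toLp (memLp_fibre F hF g), coeFn_mul f g,
      coeFn_mul ((memLp_fibre F hF f).toLp _) ((memLp_fibre F hF g).toLp _)] with ω h1 h2 h3 h4 h5
    rw [h1, h5, h2, h3, h4, map_mul]
  map_zero' := by
    apply Lp.ext
    filter_upwards [MemLp.coeFn_toLp (memLp_fibre F hF (0 : Lp A ∞ μ)),
      Lp.coeFn_zero A ∞ μ] with ω h1 h2
    rw [h1, h2]; simp
  map_add' f g := by
    apply Lp.ext
    filter_upwards [MemLp.coeFn_toLp (memLp_fibre F hF (f + g)),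
      MemLp.coeFn_toLp (memLp_fibre F hF f), MemLp.coeFn_toLp (memLp_fibre F hF g), coeFn_add f g,
      coeFn_add ((memLp_fibre F hF f).toLp _) ((memLp_fibre F hF g).toLp _)] with ω h1 h2 h3 h4 h5
    rw [h1, h5, h2, h3, h4, map_add]
  commutes' c := by
    rw [Algebra.algebraMap_eq_smul_one]
    apply Lp.ext
    filter_upwards [MemLp.coeFn_toLp (memLp_fibre F hF (c • (1 : Lp A ∞ μ))),
      coeFn_smul c (1 : Lp A ∞ μ), coeFn_one (A := A) (μ := μ)] with ω h1 h2 h3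
    rw [h1, h2, h3, map_smul, map_one]
  map_star' f := by
    apply Lp.ext
    filter_upwards [MemLp.coeFn_toLp (memLp_fibre F hF (star f)),
      MemLp.coeFn_toLp (memLp_fibre F hF f), coeFn_star f,
      coeFn_star ((memLp_fibre F hF f).toLp _)] with ω h1 h2 h3 h4
    rw [h1, h4, h2, h3, map_star]

theorem coeFn_fibreHom [TopologicalSpace.SeparableSpace A] (F : Ω → A →⋆ₐ[ℂ] A)
    (hF : ∀ a, StronglyMeasurable fun ω => F ω a) (f : Lp A ∞ μ) :
    ∀ᵐ ω ∂μ, fibreHom (μ := μ) F hF f ω = F ω (f ω) :=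
  MemLp.coeFn_toLp (memLp_fibre F hF f)

end LInfinity

open LInfinity

/-- The C*-algebra `A ⊗ L^∞(Ω, μ)`: the closed *-subalgebra of `L^∞(Ω, μ; A)` generated by the
elementary tensors. -/
def disorderedAlgebra (A : Type*) [CStarAlgebra A] {Ω : Type*} [MeasurableSpace Ω]
    (μ : Measure Ω) : StarSubalgebra ℂ (Lp A ∞ μ) :=
  (StarAlgebra.adjoin ℂ {F : Lp A ∞ μ | ∃ a f, F = tensor a f}).topologicalClosure

theorem tensor_mem_disorderedAlgebra {A : Type*} [CStarAlgebra A] {Ω : Type*} [MeasurableSpace Ω]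
    {μ : Measure Ω} (a : A) (f : Lp ℂ ∞ μ) : tensor a f ∈ disorderedAlgebra A μ :=
  StarSubalgebra.le_topologicalClosure _ (StarAlgebra.subset_adjoin ℂ _ ⟨a, f, rfl⟩)

instance {A : Type*} [CStarAlgebra A] {Ω : Type*} [MeasurableSpace Ω] (μ : Measure Ω) :
    IsClosed (disorderedAlgebra A μ : Set (Lp A ∞ μ)) :=
  StarSubalgebra.isClosed_topologicalClosure _

theorem fibreHom_mem {A : Type*} [CStarAlgebra A] [TopologicalSpace.SeparableSpace A]
    {Ω : Type*} [MeasurableSpace Ω] {μ : Measure Ω} (F : Ω → A →⋆ₐ[ℂ] A)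
    (hF : ∀ a, StronglyMeasurable fun ω => F ω a)
    (hloc : ∀ a, ∃ G ∈ disorderedAlgebra A μ, ∀ᵐ ω ∂μ, G ω = F ω a)
    (f : Lp A ∞ μ) (hf : f ∈ disorderedAlgebra A μ) :
    fibreHom F hF f ∈ disorderedAlgebra A μ := by
  have key : disorderedAlgebra A μ ≤ (disorderedAlgebra A μ).comap (fibreHom F hF) := by
    refine StarSubalgebra.topologicalClosure_minimal (StarAlgebra.adjoin_le ?_) ?_
    · rintro _ ⟨a, f, rfl⟩
      obtain ⟨G, hG, hGa⟩ := hloc a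
      have h : fibreHom F hF (tensor a f) = tensor 1 f * G := by
        apply Lp.ext
        filter_upwards [coeFn_fibreHom F hF (tensor a f), coeFn_mul (tensor 1 f) G, hGa,
          ContinuousLinearMap.coeFn_compLp (ContinuousLinearMap.toSpanSingleton ℂ a) f,
          ContinuousLinearMap.coeFn_compLp (ContinuousLinearMap.toSpanSingleton ℂ (1 : A)) f]
          with ω h1 h2 h3 h4 h5
        rw [h1, h2, h3, tensor, tensor, h4, h5]
        simp
      change fibreHom F hF (tensor a f) ∈ disorderedAlgebra A μ
      rw [h]
      exact mul_mem (tensor_mem_disorderedAlgebra 1 f) hG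
    · exact (inferInstance : IsClosed (disorderedAlgebra A μ : Set (Lp A ∞ μ))).preimage
        (AddMonoidHomClass.continuous_of_bound (fibreHom (μ := μ) F hF) 1
          (fun a => by simpa using NonUnitalStarAlgHom.norm_apply_le (fibreHom (μ := μ) F hF) a))
  exact key hf

/-- The action on `A ⊗ L^∞(Ω, μ)` of a measurable field of *-endomorphisms of `A` that acts
locally. -/
def fibreAction {A : Type*} [CStarAlgebra A] [TopologicalSpace.SeparableSpace A]
    {Ω : Type*} [MeasurableSpace Ω] {μ : Measure Ω} (F : Ω → A →⋆ₐ[ℂ] A)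
    (hF : ∀ a, StronglyMeasurable fun ω => F ω a)
    (hloc : ∀ a, ∃ G ∈ disorderedAlgebra A μ, ∀ᵐ ω ∂μ, G ω = F ω a) :
    disorderedAlgebra A μ →⋆ₐ[ℂ] disorderedAlgebra A μ :=
  ((fibreHom F hF).comp (disorderedAlgebra A μ).subtype).codRestrict (disorderedAlgebra A μ)
    (fun f => fibreHom_mem F hF hloc f f.2)

/-! ### The model -/

/-- A disordered `ℤ₂`-graded system on the lattice `ℤ^d`: a C*-algebra `A` with a grading `σ` and
spatial translations `α`, a sample space `(Ω, μ)` with a measure preserving action `shift` of the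
spatial translations, and a random one-parameter group `τ` of automorphisms of `A`, jointly
measurable, acting locally, covariant under the translations and even. -/
structure DisorderedSystem (d : ℕ) (A : Type*) [CStarAlgebra A] {Ω : Type*} [MeasurableSpace Ω]
    (μ : Measure Ω) where
  σ : A ≃⋆ₐ[ℂ] A
  σ_σ : ∀ a, σ (σ a) = a
  α : (Fin d → ℤ) → A ≃⋆ₐ[ℂ] A
  α_zero : ∀ a, α 0 a = a
  α_add : ∀ x y a, α (x + y) a = α x (α y a)
  σ_α : ∀ x a, σ (α x a) = α x (σ a)
  shift : (Fin d → ℤ) → Ω → Ω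
  shift_zero : ∀ ω, shift 0 ω = ω
  shift_add : ∀ x y ω, shift (x + y) ω = shift x (shift y ω)
  shift_measurePreserving : ∀ x, MeasurePreserving (shift x) μ μ
  τ : ℝ → Ω → A ≃⋆ₐ[ℂ] A
  τ_zero : ∀ ω a, τ 0 ω a = a
  τ_add : ∀ s t ω a, τ (s + t) ω a = τ s ω (τ t ω a)
  τ_measurable : ∀ a, StronglyMeasurable fun p : ℝ × Ω => τ p.1 p.2 a
  τ_isLocal : ∀ t a, ∃ G ∈ disorderedAlgebra A μ, ∀ᵐ ω ∂μ, G ω = τ t ω a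
  τ_covariant : ∀ x ω t a, τ t (shift x ω) (α x a) = α x (τ t ω a)
  τ_even : ∀ t a, ∀ᵐ ω ∂μ, τ t ω (σ a) = σ (τ t ω a)

namespace DisorderedSystem

variable {d : ℕ} {A : Type*} [CStarAlgebra A] [TopologicalSpace.SeparableSpace A]
  {Ω : Type*} [MeasurableSpace Ω] {μ : Measure Ω} [IsProbabilityMeasure μ]

/-- The time evolution of `A ⊗ L^∞(Ω, μ)`: `f` evolves to `ω ↦ τ t ω (f ω)`. -/
def evolution (D : DisorderedSystem d A μ) (t : ℝ) :
    disorderedAlgebra A μ →⋆ₐ[ℂ] disorderedAlgebra A μ :=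
  fibreAction (fun ω => (D.τ t ω : A →⋆ₐ[ℂ] A))
    (fun a => (D.τ_measurable a).comp_measurable measurable_prodMk_left) (D.τ_isLocal t)

/-- The grading `σ ⊗ id` of `A ⊗ L^∞(Ω, μ)`: `f` is sent to `ω ↦ σ (f ω)`. -/
def grading (D : DisorderedSystem d A μ) :
    disorderedAlgebra A μ →⋆ₐ[ℂ] disorderedAlgebra A μ :=
  fibreAction (fun _ => (D.σ : A →⋆ₐ[ℂ] A)) (fun _ => stronglyMeasurable_const)
    (fun a => ⟨_, tensor_mem_disorderedAlgebra (D.σ a) (Lp.const ∞ μ (1 : ℂ)),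
      coeFn_const_tensor (D.σ a)⟩)

end DisorderedSystem

/-! ### States, the KMS condition and GNS representations -/

section Algebra

variable {B : Type*} [CStarAlgebra B]

/-- Positive linear forms. -/
def IsPositiveForm (φ : B →ₗ[ℂ] ℂ) : Prop :=
  ∀ a, 0 ≤ (φ (star a * a)).re ∧ (φ (star a * a)).im = 0

/-- States: normalized positive linear forms. -/
def IsState (φ : B →ₗ[ℂ] ℂ) : Prop :=
  IsPositiveForm φ ∧ φ 1 = 1

/-- The entire function that extends the Fourier transform of `g`. -/
def fourierLaplace (g : ℝ → ℂ) (z : ℂ) : ℂ :=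
  ∫ s : ℝ, Complex.exp (-Complex.I * s * z) * g s

/-- The KMS boundary condition at inverse temperature `β` with respect to the evolution `τ`. -/
def IsKMS (τ : ℝ → B →⋆ₐ[ℂ] B) (β : ℝ) (φ : B →ₗ[ℂ] ℂ) : Prop :=
  (∀ a b, Continuous fun t => φ (a * τ t b)) ∧
  ∀ a b, ∀ g : ℝ → ℂ, ContDiff ℝ (⊤ : ℕ∞) g → HasCompactSupport g →
    ∫ t : ℝ, φ (a * τ t b) * fourierLaplace g t =
      ∫ t : ℝ, φ (τ t b * a) * fourierLaplace g (t + Complex.I * β)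

variable {H : Type*} [NormedAddCommGroup H] [InnerProductSpace ℂ H] [CompleteSpace H]

/-- `(H, π, Ψ)` is the GNS triple of the positive form `φ`: a representation with a cyclic vector
that induces `φ`. -/
def IsGNS (φ : B →ₗ[ℂ] ℂ) (π : B →⋆ₐ[ℂ] (H →L[ℂ] H)) (Ψ : H) : Prop :=
  (∀ a, φ a = inner ℂ Ψ (π a Ψ)) ∧ Dense (Set.range fun a => π a Ψ)

/-- The von Neumann algebra generated by a representation, as the bicommutant of its range. -/
def generatedVN (π : B →⋆ₐ[ℂ] (H →L[ℂ] H)) : Set (H →L[ℂ] H) :=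
  Set.centralizer (Set.centralizer (Set.range π))

/-- The centre of the von Neumann algebra generated by a representation. -/
def centreVN (π : B →⋆ₐ[ℂ] (H →L[ℂ] H)) : Set (H →L[ℂ] H) :=
  generatedVN π ∩ Set.centralizer (generatedVN π)

/-- `V` is the unitary that implements the automorphism `θ` covariantly in the cyclic
representation `(H, π, Ψ)`. -/
def Implements (π : B →⋆ₐ[ℂ] (H →L[ℂ] H)) (Ψ : H) (θ : B → B) (V : H →L[ℂ] H) : Prop :=
  V ∈ unitary (H →L[ℂ] H) ∧ V Ψ = Ψ ∧ ∀ a, V * π a * star V = π (θ a)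

/-- A bounded operator `T` is even: the unitary `V` implementing the grading exists and
`V T V = T`. -/
def IsEvenOperator (π : B →⋆ₐ[ℂ] (H →L[ℂ] H)) (Ψ : H) (θ : B → B) (T : H →L[ℂ] H) : Prop :=
  ∃ V : H →L[ℂ] H, Implements π Ψ θ V ∧ V * T * V = T

/-- The vector form `a ↦ ⟨π(a) T^{1/2} Ψ, T^{1/2} Ψ⟩` of a bounded positive `T` equals `ψ`. -/
def Describes (π : B →⋆ₐ[ℂ] (H →L[ℂ] H)) (Ψ : H) (T : H →L[ℂ] H) (ψ : B →ₗ[ℂ] ℂ) : Prop :=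
  ∀ a, ψ a = inner ℂ (CFC.sqrt T Ψ) (π a (CFC.sqrt T Ψ))

end Algebra

/-! ### Possibly unbounded operators -/

section Unbounded

variable {H : Type*} [NormedAddCommGroup H] [InnerProductSpace ℂ H] [CompleteSpace H]

/-- Positive self-adjoint, possibly unbounded, operators. Self-adjointness includes that the
domain is dense. -/
def IsPositiveSelfAdjoint (T : H →ₗ.[ℂ] H) : Prop :=
  IsSelfAdjoint T ∧ ∀ x : T.domain, 0 ≤ (inner ℂ (x : H) (T x)).re

/-- `T` is affiliated with the von Neumann algebra `M`: every unitary `U` of the commutant of `M`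
satisfies `U T = T U`, that is, maps the graph of `T` onto itself (the inclusion suffices, as
`U⁻¹` is such a unitary too). -/
def IsAffiliated (M : Set (H →L[ℂ] H)) (T : H →ₗ.[ℂ] H) : Prop :=
  ∀ U ∈ Set.centralizer M, U ∈ unitary (H →L[ℂ] H) →
    ∀ x y, (x, y) ∈ T.graph → (U x, U y) ∈ T.graph

/-- `S` is the positive square root of `T`: it is positive self-adjoint, and `S S = T` with the
natural domain of the composition. -/
def IsPositiveSqrt (S T : H →ₗ.[ℂ] H) : Prop :=
  IsPositiveSelfAdjoint S ∧
    ∀ x y, (x, y) ∈ T.graph ↔ ∃ z, (x, z) ∈ S.graph ∧ (z, y) ∈ S.graph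

end Unbounded

/-! ### States of the disordered system -/

section States

variable {A : Type*} [CStarAlgebra A] {Ω : Type*} [MeasurableSpace Ω] {μ : Measure Ω}

/-- The restriction of `φ` to `1 ⊗ L^∞(Ω, μ)` is normal. -/
def IsNormalOnCentre (φ : disorderedAlgebra A μ →ₗ[ℂ] ℂ) : Prop :=
  ∃ g : Ω → ℂ, Integrable g μ ∧
    ∀ f : Lp ℂ ∞ μ, φ ⟨tensor 1 f, tensor_mem_disorderedAlgebra 1 f⟩ = ∫ ω, f ω * g ω ∂μ

/-- The direct integral decomposition `φ(F) = ∫ φ_ω(F(ω)) dμ(ω)` through a field of positive forms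
on `A`. The integrability of `ω ↦ φ_ω(F(ω))` contains the weak-* measurability of the field. -/
def IsDisintegration (φ : disorderedAlgebra A μ →ₗ[ℂ] ℂ) (φfib : Ω → A →ₗ[ℂ] ℂ) : Prop :=
  (∀ ω, IsPositiveForm (φfib ω)) ∧
  ∀ F : disorderedAlgebra A μ, Integrable (fun ω => φfib ω ((F : Lp A ∞ μ) ω)) μ ∧
    φ F = ∫ ω, φfib ω ((F : Lp A ∞ μ) ω) ∂μ

/-- The field `T(ω)` of positive operators, each affiliated with the centre of the von Neumann
algebra generated by `π_ω`, with `Ψ_ω` in the domain of `T(ω)^{1/2}` almost surely, describes `ψ`: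
`ψ(F) = ∫ ⟨π_ω(F(ω)) T(ω)^{1/2} Ψ_ω, T(ω)^{1/2} Ψ_ω⟩ dμ(ω)`.
Here `η ω` is the vector `T(ω)^{1/2} Ψ_ω`. -/
def FibrewiseDescribes {K : Ω → Type*} [∀ ω, NormedAddCommGroup (K ω)]
    [∀ ω, InnerProductSpace ℂ (K ω)] [∀ ω, CompleteSpace (K ω)]
    (π : ∀ ω, A →⋆ₐ[ℂ] (K ω →L[ℂ] K ω)) (Ψ : ∀ ω, K ω) (T : ∀ ω, K ω →ₗ.[ℂ] K ω)
    (ψ : disorderedAlgebra A μ →ₗ[ℂ] ℂ) : Prop :=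
  ∃ η : ∀ ω, K ω,
    (∀ᵐ ω ∂μ, IsPositiveSelfAdjoint (T ω) ∧ IsAffiliated (centreVN (π ω)) (T ω) ∧
      ∃ S : K ω →ₗ.[ℂ] K ω, IsPositiveSqrt S (T ω) ∧ (Ψ ω, η ω) ∈ S.graph) ∧
    ∀ F : disorderedAlgebra A μ,
      Integrable (fun ω => inner ℂ (η ω) (π ω ((F : Lp A ∞ μ) ω) (η ω))) μ ∧
      ψ F = ∫ ω, inner ℂ (η ω) (π ω ((F : Lp A ∞ μ) ω) (η ω)) ∂μ

end States

end

/-! ### The bounded transform of a positive self-adjoint operator -/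

section BoundedTransform

variable {H : Type*} [NormedAddCommGroup H] [InnerProductSpace ℂ H] [CompleteSpace H]

theorem mem_graph_iff_of_isSelfAdjoint {S : H →ₗ.[ℂ] H} (hS : IsSelfAdjoint S) (x y : H) :
    (x, y) ∈ S.graph ↔ ∀ u v, (u, v) ∈ S.graph → inner ℂ v x = inner ℂ u y := by
  conv_lhs => rw [← LinearPMap.isSelfAdjoint_def.mp hS,
    LinearPMap.adjoint_graph_eq_graph_adjoint hS.dense_domain]
  simp [Submodule.mem_adjoint_iff, sub_eq_zero, -LinearPMap.mem_graph_iff]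

/-- The Hilbert space `H × H` is the orthogonal sum of the graph of a self-adjoint operator and
the rotated graph. -/
theorem exists_graph_decomposition {S : H →ₗ.[ℂ] H} (hS : IsSelfAdjoint S) (x y : H) :
    ∃ u v p q, (u, v) ∈ S.graph ∧ (p, q) ∈ S.graph ∧ x = u - q ∧ y = v + p := by
  let G : Submodule ℂ (WithLp 2 (H × H)) :=
    S.graph.comap (WithLp.linearEquiv 2 ℂ (H × H)).toLinearMap
  have hG : IsClosed (G : Set (WithLp 2 (H × H))) :=
    hS.isClosed.preimage (WithLp.prod_continuous_ofLp 2 H H)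
  have : CompleteSpace G := hG.completeSpace_coe
  obtain ⟨g, hg, k, hk, hgk⟩ := G.exists_add_mem_mem_orthogonal (WithLp.toLp 2 (x, y))
  have hx : x = g.fst + k.fst := congrArg WithLp.fst hgk
  have hy : y = g.snd + k.snd := congrArg WithLp.snd hgk
  refine ⟨g.fst, g.snd, k.snd, -k.fst, hg, ?_, by rw [hx, sub_neg_eq_add], hy⟩
  rw [mem_graph_iff_of_isSelfAdjoint hS]
  intro u v huv
  have h := (Submodule.mem_orthogonal _ _).mp hk (WithLp.toLp 2 (u, v)) huv
  rw [WithLp.prod_inner_apply] at h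
  rw [inner_neg_right]
  exact eq_neg_of_add_eq_zero_right h

theorem eq_zero_of_graph_chain {S : H →ₗ.[ℂ] H} (hS : IsSelfAdjoint S) {x y z : H}
    (hxy : (x, y) ∈ S.graph) (hyz : (y, z) ∈ S.graph) (h : x + z = 0) : x = 0 ∧ y = 0 := by
  have h1 : inner ℂ y y = inner ℂ x z := (mem_graph_iff_of_isSelfAdjoint hS y z).mp hyz x y hxy
  rw [eq_neg_of_add_eq_zero_right h, inner_neg_right, inner_self_eq_norm_sq_to_K,
    inner_self_eq_norm_sq_to_K] at h1
  have h2 : ‖y‖ ^ 2 = -‖x‖ ^ 2 := by exact_mod_cast h1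
  have hx : ‖x‖ = 0 := by nlinarith [sq_nonneg ‖x‖, sq_nonneg ‖y‖]
  have hy : ‖y‖ = 0 := by nlinarith [sq_nonneg ‖x‖, sq_nonneg ‖y‖]
  exact ⟨norm_eq_zero.mp hx, norm_eq_zero.mp hy⟩

theorem norm_sq_add_le_of_graph_chain {S : H →ₗ.[ℂ] H} (hS : IsSelfAdjoint S) {x y z : H}
    (hxy : (x, y) ∈ S.graph) (hyz : (y, z) ∈ S.graph) :
    ‖x‖ ^ 2 + ‖y‖ ^ 2 ≤ ‖x + z‖ ^ 2 := by
  have h1 : inner ℂ y y = inner ℂ x z := (mem_graph_iff_of_isSelfAdjoint hS y z).mp hyz x y hxy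
  have h2 : RCLike.re (inner ℂ x z) = ‖y‖ ^ 2 := by rw [← h1, inner_self_eq_norm_sq]
  rw [norm_add_sq (𝕜 := ℂ), h2]
  nlinarith [sq_nonneg ‖z‖, sq_nonneg ‖y‖]

/-- For a self-adjoint `S` there are bounded operators `R = (1 + S²)⁻¹` and `B = S (1 + S²)⁻¹`. -/
theorem exists_bounded_transform {S : H →ₗ.[ℂ] H} (hS : IsSelfAdjoint S) :
    ∃ R B : H →L[ℂ] H, (∀ h, (R h, B h) ∈ S.graph ∧ (B h, h - R h) ∈ S.graph) ∧
      ∀ x y z, (x, y) ∈ S.graph → (y, z) ∈ S.graph → R (x + z) = x ∧ B (x + z) = y := by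
  have hex : ∀ h : H, ∃ p : H × H, (p.1, p.2) ∈ S.graph ∧ (p.2, h - p.1) ∈ S.graph := by
    intro h
    obtain ⟨u, v, p, q, huv, hpq, h1, h2⟩ := exists_graph_decomposition hS h 0
    refine ⟨(u, v), huv, ?_⟩
    have h3 : p = -v := eq_neg_of_add_eq_zero_right h2.symm
    have h4 := S.graph.neg_mem hpq
    rw [h3] at h4
    simpa [h1, -LinearPMap.mem_graph_iff] using h4
  choose r hr1 hr2 using hex
  have huniq : ∀ x y z, (x, y) ∈ S.graph → (y, z) ∈ S.graph →
      (r (x + z)).1 = x ∧ (r (x + z)).2 = y := by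
    intro x y z hxy hyz
    have h := eq_zero_of_graph_chain hS (S.graph.sub_mem (hr1 (x + z)) hxy)
      (S.graph.sub_mem (hr2 (x + z)) hyz)
      (show (r (x + z)).1 - x + (x + z - (r (x + z)).1 - z) = 0 by abel)
    exact ⟨sub_eq_zero.mp h.1, sub_eq_zero.mp h.2⟩
  have hadd : ∀ h k, (r (h + k)).1 = (r h).1 + (r k).1 ∧ (r (h + k)).2 = (r h).2 + (r k).2 := by
    intro h k
    have := huniq _ _ _ (S.graph.add_mem (hr1 h) (hr1 k)) (S.graph.add_mem (hr2 h) (hr2 k))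
    have e : (r h).1 + (r k).1 + (h - (r h).1 + (k - (r k).1)) = h + k := by abel
    rwa [e] at this
  have hsmul : ∀ (c : ℂ) h, (r (c • h)).1 = c • (r h).1 ∧ (r (c • h)).2 = c • (r h).2 := by
    intro c h
    have := huniq _ _ _ (S.graph.smul_mem c (hr1 h)) (S.graph.smul_mem c (hr2 h))
    have e : c • (r h).1 + c • (h - (r h).1) = c • h := by rw [smul_sub]; abel
    rwa [e] at this
  have hle : ∀ h, ‖(r h).1‖ ^ 2 + ‖(r h).2‖ ^ 2 ≤ ‖h‖ ^ 2 := by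
    intro h
    simpa using norm_sq_add_le_of_graph_chain hS (hr1 h) (hr2 h)
  let R₀ : H →ₗ[ℂ] H := ⟨⟨fun h => (r h).1, fun h k => (hadd h k).1⟩, fun c h => (hsmul c h).1⟩
  let B₀ : H →ₗ[ℂ] H := ⟨⟨fun h => (r h).2, fun h k => (hadd h k).2⟩, fun c h => (hsmul c h).2⟩
  refine ⟨R₀.mkContinuous 1 fun h => ?_, B₀.mkContinuous 1 fun h => ?_,
    fun h => ⟨hr1 h, hr2 h⟩, huniq⟩
  · rw [one_mul]
    exact (sq_le_sq₀ (norm_nonneg _) (norm_nonneg _)).mp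
      ((le_add_of_nonneg_right (sq_nonneg _)).trans (hle h))
  · rw [one_mul]
    exact (sq_le_sq₀ (norm_nonneg _) (norm_nonneg _)).mp
      ((le_add_of_nonneg_left (sq_nonneg _)).trans (hle h))

/-- The square root of a positive self-adjoint operator commutes with every bounded operator that
is a linear combination of unitaries commuting with the operator. -/
theorem map_graph_sqrt_of_mem_span {S T : H →ₗ.[ℂ] H} (hS : IsPositiveSqrt S T)
    {W : Set (H →L[ℂ] H)} (hW : ∀ U ∈ W, ∀ x y, (x, y) ∈ T.graph → (U x, U y) ∈ T.graph)
    {X : H →L[ℂ] H} (hX : X ∈ Submodule.span ℂ W) {x y : H} (hxy : (x, y) ∈ S.graph) :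
    (X x, X y) ∈ S.graph := by
  obtain ⟨⟨hSsa, hSpos⟩, hST⟩ := hS
  obtain ⟨R, B, hRB, huniq⟩ := exists_bounded_transform hSsa
  have hinner : ∀ {x y u v}, (x, y) ∈ S.graph → (u, v) ∈ S.graph → inner ℂ v x = inner ℂ u y :=
    fun hxy huv => (mem_graph_iff_of_isSelfAdjoint hSsa _ _).mp hxy _ _ huv
  have hpos : ∀ {x y}, (x, y) ∈ S.graph → 0 ≤ (inner ℂ x y).re := by
    intro x y hxy
    obtain ⟨u, rfl, rfl⟩ := (LinearPMap.mem_graph_iff S).mp hxy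
    exact hSpos u
  -- `R S ⊆ S R = B`
  have hswap : ∀ {x y}, (x, y) ∈ S.graph → R y = B x ∧ B y = x - R x := by
    intro x y hxy
    have h := huniq _ _ _ (hRB x).2 (S.graph.sub_mem hxy (hRB x).1)
    simpa using h
  have hconv : ∀ {x y}, R y = B x → (x, y) ∈ S.graph := by
    intro x y h
    obtain ⟨u, v, p, q, huv, hpq, rfl, rfl⟩ := exists_graph_decomposition hSsa x y
    rw [map_add, map_sub, (hswap huv).1, (hswap hpq).2] at h
    have hp : p = 0 := by
      have : R p = -(p - R p) := by
        have h' := congrArg (fun w => w - B u) h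
        simpa using h'
      rw [neg_sub] at this
      exact (sub_eq_self.mp this.symm)
    have hq : q = 0 := S.graph_fst_eq_zero_snd hpq hp
    simpa [hp, hq, -LinearPMap.mem_graph_iff] using huv
  have hBB : B * B = R - R * R := by
    ext h
    exact (hswap (hRB h).1).2
  have hBpos : 0 ≤ B := by
    rw [ContinuousLinearMap.nonneg_iff_isPositive, ContinuousLinearMap.isPositive_iff_complex]
    intro h
    have e : inner ℂ (B h) h = inner ℂ (R h) (B h) + inner ℂ (B h) (h - R h) := by
      rw [← hinner (hRB h).1 (hRB h).1, ← inner_add_right]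
      congr 1
      abel
    have e' : inner ℂ h (B h) = inner ℂ (B h) h := by
      have h1 := hinner (hRB h).1 (hRB h).1
      have h2 := hinner (hRB h).2 (hRB h).2
      rw [e, ← h2, ← inner_add_left]
      congr 1
      abel
    refine ⟨?_, ?_⟩
    · rw [← inner_conj_symm] at e'
      exact Complex.conj_eq_iff_re.mp e'
    · rw [e]
      exact add_nonneg (hpos (hRB h).1) (hpos (hRB h).2)
  have hsqrt : CFC.sqrt (R - R * R) = B := CFC.sqrt_unique hBB hBpos
  have hRX : Commute R X := by
    induction hX using Submodule.span_induction with
    | zero => exact Commute.zero_right R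
    | add _ _ _ _ h1 h2 => exact h1.add_right h2
    | smul c _ _ h => exact h.smul_right c
    | mem U hU =>
      ext h
      have hT : (R h, h - R h) ∈ T.graph := (hST _ _).mpr ⟨B h, hRB h⟩
      obtain ⟨w, hw1, hw2⟩ := (hST _ _).mp (hW U hU _ _ hT)
      have := (huniq _ _ _ hw1 hw2).1
      rw [map_sub] at this
      simpa using this
  have hBX : Commute B X := by
    rw [← hsqrt]
    exact Commute.cfcₙ_nnreal (hRX.sub_left (hRX.mul_left hRX)) _
  apply hconv
  have h1 := congrArg (fun L : H →L[ℂ] H => L y) hRX.eq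
  have h2 := congrArg (fun L : H →L[ℂ] H => L x) hBX.eq
  simp only [mul_apply_eq_comp] at h1 h2
  rw [h1, h2, (hswap hxy).1]

end BoundedTransform

/-! ### Even operators in cyclic representations -/

section Cyclic

variable {B : Type*} [CStarAlgebra B]
variable {H : Type*} [NormedAddCommGroup H] [InnerProductSpace ℂ H] [CompleteSpace H]

/-- The linear map `a ↦ π(a) ξ`. -/
noncomputable def orbitMap (π : B →⋆ₐ[ℂ] (H →L[ℂ] H)) (ξ : H) : B →ₗ[ℂ] H where
  toFun a := π a ξ
  map_add' a b := by simp
  map_smul' c a := by simp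

theorem rep_mul_apply (π : B →⋆ₐ[ℂ] (H →L[ℂ] H)) (a b : B) (x : H) :
    π (a * b) x = π a (π b x) := by
  rw [map_mul]; rfl

theorem inner_rep_left (π : B →⋆ₐ[ℂ] (H →L[ℂ] H)) (a : B) (x y : H) :
    inner ℂ (π a x) y = inner ℂ x (π (star a) y) := by
  rw [map_star, ContinuousLinearMap.star_eq_adjoint, ContinuousLinearMap.adjoint_inner_right]

theorem inner_rep_star_mul_self (π : B →⋆ₐ[ℂ] (H →L[ℂ] H)) (a : B) (x : H) :
    inner ℂ x (π (star a * a) x) = ((‖π a x‖ ^ 2 : ℝ) : ℂ) := by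
  rw [rep_mul_apply, ← inner_rep_left, inner_self_eq_norm_sq_to_K]
  push_cast
  rfl

theorem continuous_rep_apply (π : B →⋆ₐ[ℂ] (H →L[ℂ] H)) (x : H) : Continuous fun a => π a x := by
  have hπ : Continuous π := AddMonoidHomClass.continuous_of_bound π 1
    (fun a => by simpa using NonUnitalStarAlgHom.norm_apply_le π a)
  fun_prop

theorem eq_of_eq_on_orbit {π : B →⋆ₐ[ℂ] (H →L[ℂ] H)} {Ψ : H}
    (hd : Dense (Set.range fun a => π a Ψ)) {X Y : H →L[ℂ] H}
    (h : ∀ a, X (π a Ψ) = Y (π a Ψ)) : X = Y := by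
  have := Continuous.ext_on hd X.continuous Y.continuous (by rintro _ ⟨a, rfl⟩; exact h a)
  exact DFunLike.coe_injective this

/-- In a cyclic representation, `π(a) Ψ ↦ π(θ(a)) η` extends to a bounded operator as soon as it is
bounded. -/
theorem exists_extension_of_orbit {π : B →⋆ₐ[ℂ] (H →L[ℂ] H)} {Ψ : H}
    (hd : Dense (Set.range fun a => π a Ψ)) (θ : B →⋆ₐ[ℂ] B) (η : H) {C : ℝ}
    (hC : ∀ a, ‖π (θ a) η‖ ≤ C * ‖π a Ψ‖) :
    ∃ X : H →L[ℂ] H, ∀ a, X (π a Ψ) = π (θ a) η :=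
  ⟨((orbitMap π η).comp (θ : B →ₗ[ℂ] B)).extendOfNorm (orbitMap π Ψ),
    LinearMap.extendOfNorm_eq (f := (orbitMap π η).comp (θ : B →ₗ[ℂ] B)) (e := orbitMap π Ψ)
      hd ⟨C, hC⟩⟩

/-- An involutive automorphism that leaves a positive form invariant is implemented in its GNS
representation by a unitary involution. -/
theorem exists_implements {φ : B →ₗ[ℂ] ℂ} {π : B →⋆ₐ[ℂ] (H →L[ℂ] H)} {Ψ : H} (hπ : IsGNS φ π Ψ)
    (θ : B →⋆ₐ[ℂ] B) (hθ : ∀ a, θ (θ a) = a) (hφ : ∀ a, φ (θ a) = φ a) :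
    ∃ V : H →L[ℂ] H, Implements π Ψ θ V ∧ star V = V ∧ V * V = 1 := by
  obtain ⟨hφπ, hd⟩ := hπ
  have hnorm : ∀ a, ‖π (θ a) Ψ‖ = ‖π a Ψ‖ := by
    intro a
    have h : ((‖π (θ a) Ψ‖ ^ 2 : ℝ) : ℂ) = ((‖π a Ψ‖ ^ 2 : ℝ) : ℂ) := by
      rw [← inner_rep_star_mul_self, ← inner_rep_star_mul_self, ← hφπ, ← hφπ, ← hφ (star a * a),
        map_mul θ, map_star θ]
    exact (sq_eq_sq₀ (norm_nonneg _) (norm_nonneg _)).mp (by exact_mod_cast h)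
  obtain ⟨V, hV⟩ := exists_extension_of_orbit hd θ Ψ (C := 1) (fun a => by rw [hnorm, one_mul])
  have hVV : V * V = 1 := eq_of_eq_on_orbit hd fun a => by
    simp [mul_apply_eq_comp, hV, hθ]
  have hiso : ∀ x, ‖V x‖ = ‖x‖ := by
    intro x
    refine hd.induction (P := fun x => ‖V x‖ = ‖x‖) ?_
      (isClosed_eq (by fun_prop) (by fun_prop)) x
    rintro _ ⟨a, rfl⟩
    simp only [hV, hnorm]
  have hsV : star V * V = 1 := by
    rw [ContinuousLinearMap.star_eq_adjoint]
    exact (ContinuousLinearMap.norm_map_iff_adjoint_comp_self V).mp hiso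
  have hsa : star V = V := by
    calc star V = star V * (V * V) := by rw [hVV, mul_one]
      _ = V := by rw [← mul_assoc, hsV, one_mul]
  refine ⟨V, ⟨Unitary.mem_iff.mpr ⟨hsV, by rw [hsa, hVV]⟩, ?_, fun a => ?_⟩, hsa, hVV⟩
  · simpa using hV 1
  · rw [hsa]
    refine eq_of_eq_on_orbit hd fun b => ?_
    rw [mul_apply_eq_comp, mul_apply_eq_comp, hV, ← rep_mul_apply, hV, map_mul θ, hθ,
      rep_mul_apply]

/-- An operator in the commutant whose form `a ↦ ⟨Ψ, π(a) T Ψ⟩` is even is itself even. -/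
theorem isEvenOperator_of_form {φ : B →ₗ[ℂ] ℂ} {π : B →⋆ₐ[ℂ] (H →L[ℂ] H)} {Ψ : H}
    (hπ : IsGNS φ π Ψ) (θ : B →⋆ₐ[ℂ] B) (hθ : ∀ a, θ (θ a) = a) (hφ : ∀ a, φ (θ a) = φ a)
    {T : H →L[ℂ] H} (hT : ∀ a, Commute T (π a))
    (hform : ∀ a, inner ℂ Ψ (π (θ a) (T Ψ)) = inner ℂ Ψ (π a (T Ψ))) :
    IsEvenOperator π Ψ θ T := by
  obtain ⟨V, hV, hsa, hVV⟩ := exists_implements hπ θ hθ hφ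
  obtain ⟨-, hVΨ, hVπ⟩ := id hV
  rw [hsa] at hVπ
  refine ⟨V, hV, ?_⟩
  have hcomm : ∀ a, Commute (V * T * V) (π a) := by
    intro a
    have h1 : V * π a = π (θ a) * V := by
      rw [← hVπ, mul_assoc, mul_assoc, hVV, mul_one]
    have h2 : V * π (θ a) = π a * V := by
      conv_rhs => rw [← hθ a, ← hVπ (θ a)]
      rw [mul_assoc, mul_assoc, hVV, mul_one]
    calc V * T * V * π a = V * (T * π (θ a)) * V := by simp only [mul_assoc, h1]
      _ = π a * (V * T * V) := by rw [(hT (θ a)).eq, ← mul_assoc V, h2]; simp only [mul_assoc]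
  have hsymm : ∀ x y, inner ℂ (V x) y = inner ℂ x (V y) := by
    intro x y
    conv_rhs => rw [← hsa, ContinuousLinearMap.star_eq_adjoint,
      ContinuousLinearMap.adjoint_inner_right]
  have hΨ : V (T Ψ) = T Ψ := by
    refine hπ.2.eq_of_inner_right ℂ ?_
    rintro _ ⟨a, rfl⟩
    have hVa : V (π a Ψ) = π (θ a) Ψ := by
      rw [← hVπ, mul_apply_eq_comp, mul_apply_eq_comp, hVΨ]
    simp only
    rw [← hsymm, hVa, inner_rep_left, inner_rep_left, ← map_star, hform]
  refine eq_of_eq_on_orbit hπ.2 fun a => ?_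
  rw [← mul_apply_eq_comp, ← mul_apply_eq_comp, (hcomm a).eq, (hT a).eq]
  simp only [mul_apply_eq_comp, hVΨ, hΨ]

theorem commute_rep_of_mem_centreVN {π : B →⋆ₐ[ℂ] (H →L[ℂ] H)} {T : H →L[ℂ] H}
    (hT : T ∈ centreVN π) (a : B) : Commute T (π a) :=
  (hT.2 (π a) (Set.subset_centralizer_centralizer (Set.mem_range_self a))).symm

theorem commute_sqrt {T X : H →L[ℂ] H} (h : Commute T X) : Commute (CFC.sqrt T) X :=
  Commute.cfcₙ_nnreal h _

theorem inner_sqrt_apply {T : H →L[ℂ] H} (hT : 0 ≤ T) (x y : H) :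
    inner ℂ (CFC.sqrt T x) (CFC.sqrt T y) = inner ℂ x (T y) := by
  have hsa : star (CFC.sqrt T) = CFC.sqrt T := (CFC.sqrt_nonneg T).isSelfAdjoint.star_eq
  conv_rhs => rw [← CFC.sqrt_mul_sqrt_self T hT, mul_apply_eq_comp]
  conv_lhs => rw [← hsa]
  rw [ContinuousLinearMap.star_eq_adjoint, ContinuousLinearMap.adjoint_inner_left,
    ← ContinuousLinearMap.star_eq_adjoint, hsa]

theorem Describes.eq_inner {π : B →⋆ₐ[ℂ] (H →L[ℂ] H)} {Ψ : H} {T : H →L[ℂ] H} {ψ : B →ₗ[ℂ] ℂ}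
    (h : Describes π Ψ T ψ) (hT : 0 ≤ T) (hc : ∀ a, Commute T (π a)) (a : B) :
    ψ a = inner ℂ Ψ (π a (T Ψ)) := by
  have e : π a (CFC.sqrt T Ψ) = CFC.sqrt T (π a Ψ) := by
    rw [← mul_apply_eq_comp, ← (commute_sqrt (hc a)).eq, mul_apply_eq_comp]
  rw [h a, e, inner_sqrt_apply hT, ← mul_apply_eq_comp, (hc a).eq, mul_apply_eq_comp]

/-- A form described by a bounded operator in the commutant is dominated by the reference form. -/
theorem Describes.re_le {φ : B →ₗ[ℂ] ℂ} {π : B →⋆ₐ[ℂ] (H →L[ℂ] H)} {Ψ : H} (hπ : IsGNS φ π Ψ)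
    {T : H →L[ℂ] H} {ψ : B →ₗ[ℂ] ℂ} (h : Describes π Ψ T ψ) (hc : ∀ a, Commute T (π a)) (a : B) :
    (ψ (star a * a)).re ≤ ‖CFC.sqrt T‖ ^ 2 * (φ (star a * a)).re := by
  have e : π a (CFC.sqrt T Ψ) = CFC.sqrt T (π a Ψ) := by
    rw [← mul_apply_eq_comp, ← (commute_sqrt (hc a)).eq, mul_apply_eq_comp]
  rw [h, hπ.1, inner_rep_star_mul_self, inner_rep_star_mul_self, Complex.ofReal_re,
    Complex.ofReal_re, e, ← mul_pow]
  gcongr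
  exact ContinuousLinearMap.le_opNorm _ _

/-- A positive self-adjoint operator affiliated with the centre, whose form is dominated by the
reference form and even, is bounded and even. -/
theorem exists_bounded_even {φ : B →ₗ[ℂ] ℂ} {π : B →⋆ₐ[ℂ] (H →L[ℂ] H)} {Ψ η : H}
    (hπ : IsGNS φ π Ψ) (θ : B →⋆ₐ[ℂ] B) (hθ : ∀ a, θ (θ a) = a) (hφ : ∀ a, φ (θ a) = φ a)
    {S T : H →ₗ.[ℂ] H} (hT : IsAffiliated (centreVN π) T) (hST : IsPositiveSqrt S T)
    (hη : (Ψ, η) ∈ S.graph) {C : ℝ} (hC : ∀ a, ‖π a η‖ ≤ C * ‖π a Ψ‖)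
    (heven : ∀ a, inner ℂ η (π (θ a) η) = inner ℂ η (π a η)) :
    ∃ T₀ : H →L[ℂ] H, T = (T₀ : H →ₗ[ℂ] H).toPMap ⊤ ∧ IsEvenOperator π Ψ θ T₀ := by
  have hgraph : ∀ a, (π a Ψ, π a η) ∈ S.graph := by
    intro a
    have ha : π a ∈ Submodule.span ℂ (π '' (unitary B : Set B)) := by
      have : a ∈ Submodule.span ℂ (unitary B : Set B) := by
        rw [CStarAlgebra.span_unitary]; trivial
      have h := Submodule.mem_map_of_mem (f := (π : B →ₗ[ℂ] (H →L[ℂ] H))) this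
      rw [Submodule.map_span] at h
      exact h
    refine map_graph_sqrt_of_mem_span hST ?_ ha hη
    rintro _ ⟨u, hu, rfl⟩
    refine hT _ ?_ (Unitary.map_mem π hu)
    intro Z hZ
    exact commute_rep_of_mem_centreVN hZ u
  obtain ⟨S₀, hS₀⟩ := exists_extension_of_orbit hπ.2 (StarAlgHom.id ℂ B) η (C := C) hC
  replace hS₀ : ∀ a, S₀ (π a Ψ) = π a η := hS₀
  have hmem : ∀ x, (x, S₀ x) ∈ S.graph := by
    intro x
    refine hπ.2.induction (P := fun x => (x, S₀ x) ∈ S.graph) ?_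
      (hST.1.1.isClosed.preimage (by fun_prop : Continuous fun x => (x, S₀ x))) x
    rintro _ ⟨a, rfl⟩
    simp only [hS₀]
    exact hgraph a
  have hiff : ∀ x y, (x, y) ∈ S.graph ↔ y = S₀ x := fun x y =>
    ⟨fun h => S.mem_graph_snd_inj h (hmem x) rfl, fun h => h ▸ hmem x⟩
  have hS₀Ψ : S₀ Ψ = η := by simpa using hS₀ 1
  have hcomm : ∀ a, Commute S₀ (π a) := fun a => eq_of_eq_on_orbit hπ.2 fun b => by
    simp only [mul_apply_eq_comp, ← rep_mul_apply, hS₀]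
  have hform : ∀ a, inner ℂ Ψ (π a ((S₀ * S₀) Ψ)) = inner ℂ η (π a η) := by
    intro a
    have h1 := (mem_graph_iff_of_isSelfAdjoint hST.1.1 _ _).mp (hmem (π a η)) Ψ η hη
    rw [h1, ← hS₀Ψ, ← mul_apply_eq_comp S₀ (π a), (hcomm a).eq]
    rfl
  refine ⟨S₀ * S₀, ?_, isEvenOperator_of_form hπ θ hθ hφ
    (fun a => (hcomm a).mul_left (hcomm a)) fun a => by rw [hform, hform, heven]⟩
  apply LinearPMap.eq_of_eq_graph
  ext ⟨x, y⟩
  rw [hST.2]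
  simp only [hiff, exists_eq_left]
  rw [LinearPMap.mem_graph_iff]
  simp [eq_comm]

end Cyclic

open LInfinity

/-! ### Localization in the sample space -/

section Localization

variable {A : Type*} [CStarAlgebra A] {Ω : Type*} [MeasurableSpace Ω] {μ : Measure Ω}
  [IsProbabilityMeasure μ]

/-- The element `a ⊗ 1_s` of `A ⊗ L^∞(Ω, μ)`. -/
noncomputable def indicatorTensor (μ : Measure Ω) [IsProbabilityMeasure μ] (a : A) {s : Set Ω}
    (hs : MeasurableSet s) : disorderedAlgebra A μ :=
  ⟨tensor a (indicatorConstLp ∞ hs (measure_ne_top μ s) 1), tensor_mem_disorderedAlgebra _ _⟩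

theorem coeFn_indicatorTensor (a : A) {s : Set Ω} (hs : MeasurableSet s) :
    ∀ᵐ ω ∂μ, (indicatorTensor μ a hs : Lp A ∞ μ) ω = s.indicator (fun _ => a) ω := by
  filter_upwards [ContinuousLinearMap.coeFn_compLp (ContinuousLinearMap.toSpanSingleton ℂ a)
    (indicatorConstLp ∞ hs (measure_ne_top μ s) (1 : ℂ)),
    indicatorConstLp_coeFn (p := ∞) (hs := hs) (hμs := measure_ne_top μ s) (c := (1 : ℂ))]
    with ω h1 h2
  refine h1.trans ?_
  rw [h2]
  by_cases hω : ω ∈ s <;> simp [hω]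

theorem star_mul_indicatorTensor (a : A) {s : Set Ω} (hs : MeasurableSet s) :
    star (indicatorTensor μ a hs) * indicatorTensor μ a hs = indicatorTensor μ (star a * a) hs := by
  apply Subtype.ext
  apply Lp.ext
  filter_upwards [coeFn_mul (star (indicatorTensor μ a hs : Lp A ∞ μ)) (indicatorTensor μ a hs),
    coeFn_star (indicatorTensor μ a hs : Lp A ∞ μ), coeFn_indicatorTensor (μ := μ) a hs,
    coeFn_indicatorTensor (μ := μ) (star a * a) hs] with ω h1 h2 h3 h4
  rw [h4]
  refine h1.trans ?_
  rw [h2, h3]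
  by_cases hω : ω ∈ s <;> simp [hω]

theorem grading_indicatorTensor [TopologicalSpace.SeparableSpace A] {d : ℕ}
    (D : DisorderedSystem d A μ) (a : A) {s : Set Ω} (hs : MeasurableSet s) :
    D.grading (indicatorTensor μ a hs) = indicatorTensor μ (D.σ a) hs := by
  apply Subtype.ext
  apply Lp.ext
  filter_upwards [coeFn_fibreHom (fun _ => (D.σ : A →⋆ₐ[ℂ] A)) (fun _ => stronglyMeasurable_const)
    (indicatorTensor μ a hs : Lp A ∞ μ), coeFn_indicatorTensor (μ := μ) a hs,
    coeFn_indicatorTensor (μ := μ) (D.σ a) hs] with ω h1 h2 h3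
  rw [h3]
  refine h1.trans ?_
  rw [h2]
  by_cases hω : ω ∈ s <;> simp [hω]

theorem grading_grading [TopologicalSpace.SeparableSpace A] {d : ℕ}
    (D : DisorderedSystem d A μ) (F : disorderedAlgebra A μ) : D.grading (D.grading F) = F := by
  apply Subtype.ext
  apply Lp.ext
  filter_upwards [coeFn_fibreHom (fun _ => (D.σ : A →⋆ₐ[ℂ] A)) (fun _ => stronglyMeasurable_const)
    (D.grading F : Lp A ∞ μ), coeFn_fibreHom (fun _ => (D.σ : A →⋆ₐ[ℂ] A))
    (fun _ => stronglyMeasurable_const) (F : Lp A ∞ μ)] with ω h1 h2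
  refine h1.trans ((congrArg D.σ h2).trans ?_)
  exact D.σ_σ _

section Fibres

variable {ψ : disorderedAlgebra A μ →ₗ[ℂ] ℂ} {g : Ω → A → ℂ}

theorem apply_indicatorTensor_ae_eq (hg0 : ∀ ω, g ω 0 = 0) (a : A) {s : Set Ω}
    (hs : MeasurableSet s) :
    (fun ω => g ω ((indicatorTensor μ a hs : Lp A ∞ μ) ω)) =ᵐ[μ] s.indicator fun ω => g ω a := by
  filter_upwards [coeFn_indicatorTensor (μ := μ) a hs] with ω h
  rw [h]
  by_cases hω : ω ∈ s <;> simp [hω, hg0]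

theorem integrable_fibre (hg0 : ∀ ω, g ω 0 = 0)
    (hg : ∀ F : disorderedAlgebra A μ, Integrable (fun ω => g ω ((F : Lp A ∞ μ) ω)) μ) (a : A) :
    Integrable (fun ω => g ω a) μ := by
  have h := (hg (indicatorTensor μ a MeasurableSet.univ)).congr
    (apply_indicatorTensor_ae_eq hg0 a MeasurableSet.univ)
  simpa using h

theorem apply_indicatorTensor (hg0 : ∀ ω, g ω 0 = 0)
    (hψ : ∀ F : disorderedAlgebra A μ, ψ F = ∫ ω, g ω ((F : Lp A ∞ μ) ω) ∂μ) (a : A) {s : Set Ω}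
    (hs : MeasurableSet s) : ψ (indicatorTensor μ a hs) = ∫ ω in s, g ω a ∂μ := by
  rw [hψ, integral_congr_ae (apply_indicatorTensor_ae_eq hg0 a hs), integral_indicator hs]

variable [TopologicalSpace.SeparableSpace A]

/-- The fibres of an even form are almost surely even. -/
theorem ae_even_fibre {d : ℕ} (D : DisorderedSystem d A μ)
    (hg0 : ∀ ω, g ω 0 = 0) (hgc : ∀ ω, Continuous (g ω))
    (hψ : ∀ F : disorderedAlgebra A μ, Integrable (fun ω => g ω ((F : Lp A ∞ μ) ω)) μ ∧
      ψ F = ∫ ω, g ω ((F : Lp A ∞ μ) ω) ∂μ) (heven : ∀ F, ψ (D.grading F) = ψ F) :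
    ∀ᵐ ω ∂μ, ∀ a, g ω (D.σ a) = g ω a := by
  have hint := integrable_fibre hg0 fun F => (hψ F).1
  have key : ∀ a, ∀ᵐ ω ∂μ, g ω (D.σ a) = g ω a := fun a =>
    Integrable.ae_eq_of_forall_setIntegral_eq _ _ (hint (D.σ a)) (hint a) fun s hs _ => by
      rw [← apply_indicatorTensor hg0 (fun F => (hψ F).2) _ hs,
        ← apply_indicatorTensor hg0 (fun F => (hψ F).2) _ hs, ← grading_indicatorTensor, heven]
  have hσ : Continuous D.σ := AddMonoidHomClass.continuous_of_bound D.σ 1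
    (fun a => by simpa using NonUnitalStarAlgHom.norm_apply_le D.σ a)
  filter_upwards [ae_all_iff.mpr fun n => key (TopologicalSpace.denseSeq A n)] with ω hω a
  refine (TopologicalSpace.denseRange_denseSeq A).induction
    (P := fun a => g ω (D.σ a) = g ω a) ?_
    (isClosed_eq ((hgc ω).comp hσ) (hgc ω)) a
  rintro _ ⟨n, rfl⟩
  exact hω n

/-- Domination of forms passes to almost every fibre. -/
theorem ae_re_le_fibre {ψ' : disorderedAlgebra A μ →ₗ[ℂ] ℂ} {g' : Ω → A → ℂ} {C : ℝ}
    (hg0 : ∀ ω, g ω 0 = 0) (hgc : ∀ ω, Continuous (g ω))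
    (hψ : ∀ F : disorderedAlgebra A μ, Integrable (fun ω => g ω ((F : Lp A ∞ μ) ω)) μ ∧
      ψ F = ∫ ω, g ω ((F : Lp A ∞ μ) ω) ∂μ)
    (hg0' : ∀ ω, g' ω 0 = 0) (hgc' : ∀ ω, Continuous (g' ω))
    (hψ' : ∀ F : disorderedAlgebra A μ, Integrable (fun ω => g' ω ((F : Lp A ∞ μ) ω)) μ ∧
      ψ' F = ∫ ω, g' ω ((F : Lp A ∞ μ) ω) ∂μ)
    (hle : ∀ F, (ψ (star F * F)).re ≤ C * (ψ' (star F * F)).re) :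
    ∀ᵐ ω ∂μ, ∀ a, (g ω (star a * a)).re ≤ C * (g' ω (star a * a)).re := by
  have hint := integrable_fibre hg0 fun F => (hψ F).1
  have hint' := integrable_fibre hg0' fun F => (hψ' F).1
  have key : ∀ a, ∀ᵐ ω ∂μ, (g ω (star a * a)).re ≤ C * (g' ω (star a * a)).re := fun a =>
    ae_le_of_forall_setIntegral_le (hint _).re ((hint' _).re.const_mul C) fun s hs _ => by
      have h := hle (indicatorTensor μ a hs)
      rw [star_mul_indicatorTensor, apply_indicatorTensor hg0 (fun F => (hψ F).2) _ hs,
        apply_indicatorTensor hg0' (fun F => (hψ' F).2) _ hs] at h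
      have e := integral_re (μ := μ.restrict s) (hint (star a * a)).restrict
      have e' := integral_re (μ := μ.restrict s) (hint' (star a * a)).restrict
      rw [integral_const_mul]
      exact (e.trans_le h).trans_eq (congrArg (C * ·) e'.symm)
  filter_upwards [ae_all_iff.mpr fun n => key (TopologicalSpace.denseSeq A n)] with ω hω a
  have hs : Continuous fun a : A => star a * a := by fun_prop
  refine (TopologicalSpace.denseRange_denseSeq A).induction
    (P := fun a => (g ω (star a * a)).re ≤ C * (g' ω (star a * a)).re) ?_
    (isClosed_le (Complex.continuous_re.comp ((hgc ω).comp hs))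
      (continuous_const.mul (Complex.continuous_re.comp ((hgc' ω).comp hs)))) a
  rintro _ ⟨n, rfl⟩
  exact hω n

end Fibres

end Localization

theorem proposition7p5 {d : ℕ} {A : Type*} [CStarAlgebra A] [TopologicalSpace.SeparableSpace A]
    {Ω : Type*} [MeasurableSpace Ω] [StandardBorelSpace Ω] {μ : Measure Ω} [IsProbabilityMeasure μ]
    (D : DisorderedSystem d A μ) {β : ℝ} (hβ : β ≠ 0)
    -- the reference state: an even KMS state, normal on `L^∞(Ω, μ)`, with its GNS triple
    (φ : disorderedAlgebra A μ →ₗ[ℂ] ℂ) (hφ : IsState φ)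
    (hφKMS : IsKMS D.evolution β φ) (hφnormal : IsNormalOnCentre φ)
    (hφeven : ∀ F, φ (D.grading F) = φ F)
    {H : Type*} [NormedAddCommGroup H] [InnerProductSpace ℂ H] [CompleteSpace H]
    (π : disorderedAlgebra A μ →⋆ₐ[ℂ] (H →L[ℂ] H)) (Φ : H) (hπ : IsGNS φ π Φ)
    -- the even KMS state described by the bounded positive operator `T` in the centre
    (φT : disorderedAlgebra A μ →ₗ[ℂ] ℂ) (hφT : IsState φT)
    (hφTKMS : IsKMS D.evolution β φT) (hφTeven : ∀ F, φT (D.grading F) = φT F)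
    (T : H →L[ℂ] H) (hTpos : 0 ≤ T) (hTcentre : T ∈ centreVN π) (hT : Describes π Φ T φT) :
    IsEvenOperator π Φ D.grading T ∧
    ∀ (φfib : Ω → A →ₗ[ℂ] ℂ), IsDisintegration φ φfib →
      ∀ (K : Ω → Type*) [∀ ω, NormedAddCommGroup (K ω)] [∀ ω, InnerProductSpace ℂ (K ω)]
        [∀ ω, CompleteSpace (K ω)] (πfib : ∀ ω, A →⋆ₐ[ℂ] (K ω →L[ℂ] K ω)) (Ψ : ∀ ω, K ω),
        (∀ ω, IsGNS (φfib ω) (πfib ω) (Ψ ω)) →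
        ∀ (Tfib : ∀ ω, K ω →ₗ.[ℂ] K ω), FibrewiseDescribes πfib Ψ Tfib φT →
          ∀ᵐ ω ∂μ, ∃ T₀ : K ω →L[ℂ] K ω,
            Tfib ω = (T₀ : K ω →ₗ[ℂ] K ω).toPMap ⊤ ∧
            IsEvenOperator (πfib ω) (Ψ ω) D.σ T₀ := by
  have hcomm := commute_rep_of_mem_centreVN hTcentre
  refine ⟨isEvenOperator_of_form hπ D.grading (grading_grading D) hφeven hcomm fun F => by
    rw [← hT.eq_inner hTpos hcomm, ← hT.eq_inner hTpos hcomm, hφTeven], ?_⟩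
  intro φfib hφfib K _ _ _ πfib Ψ hGNS Tfib hTfib
  obtain ⟨η, hη, hφη⟩ := hTfib
  have hvec : ∀ ω (x : K ω), Continuous fun a => inner ℂ x (πfib ω a x) := fun ω x =>
    continuous_const.inner (continuous_rep_apply (πfib ω) x)
  have hφc : ∀ ω, Continuous (φfib ω) := fun ω => by
    simpa only [← (hGNS ω).1] using hvec ω (Ψ ω)
  have h0 : ∀ ω, inner ℂ (η ω) (πfib ω 0 (η ω)) = 0 := by simp
  have heven := ae_even_fibre (g := fun ω => φfib ω) D (fun ω => map_zero _) hφc hφfib.2 hφeven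
  have hevenη := ae_even_fibre (g := fun ω a => inner ℂ (η ω) (πfib ω a (η ω))) D h0
    (fun ω => hvec ω (η ω)) hφη hφTeven
  have hle := ae_re_le_fibre (g := fun ω a => inner ℂ (η ω) (πfib ω a (η ω)))
    (g' := fun ω => φfib ω) h0 (fun ω => hvec ω (η ω)) hφη (fun ω => map_zero _) hφc hφfib.2
    (Describes.re_le hπ hT hcomm)
  filter_upwards [hη, heven, hevenη, hle] with ω ⟨_, haff, S, hS, hSη⟩ hω hωη hωle
  refine exists_bounded_even (hGNS ω) (D.σ : A →⋆ₐ[ℂ] A) D.σ_σ hω haff hS hSη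
    (C := ‖CFC.sqrt T‖) (fun a => ?_) hωη
  have h := hωle a
  rw [(hGNS ω).1, inner_rep_star_mul_self, inner_rep_star_mul_self, Complex.ofReal_re,
    Complex.ofReal_re, ← mul_pow] at h
  exact (sq_le_sq₀ (norm_nonneg _) (by positivity)).mp h
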